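/- Fix $d$ and a sequence of feature vectors $x_1,x_2,\ldots\in\mathbb R^d$, revealed sequentially, and observations $y_1,y_2,\ldots\in\mathbb R$. For $t\ge 1$ let $G_t=\sum_{s=1}^t x_sx_s^{\mathsf T}$, $b_{t-1}=\sum_{s=1}^{t-1}y_sx_s$, $r_t=\operatorname{rank}(G_t)$, and let $\lambda_1(G_t)\ge\cdots\ge\lambda_d(G_t)$ be the eigenvalues of $G_t$ with multiplicity; $M^\dagger$ is the Moore–Penrose pseudoinverse of $M$ and $\|\cdot\|$ the Euclidean norm. At round $t$, non-linear ridge regression with $\lambda=0$ uses $\hat u_t=G_t^\dagger b_{t-1}$, and predicts $\hat u_t\cdot x_t$. Its regret after $T$ rounds against $u\in\mathbb R^d$ is $$\mathcal R_T(u)=\sum_{t=1}^T (y_t-\hat u_t\cdot x_t)^2-\sum_{t=1}^T(y_t-u\cdot x_t)^2 .$$ Let $\mathcal T$ be the set consisting of the smallest $s\ge1$ such that $x_s\neq0$ (if there is one) and of all $s\ge2$ with $\operatorname{rank}(G_{s-1})\ne\operatorname{rank}(G_s)$. **Theorem.** 1. $\hat u_1=0$ and, for each $t\ge2$, $\hat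 u_t$ is the element of minimal Euclidean norm of $$\operatorname*{argmin}_{u\in\mathbb R^d}\Bigl\{\sum_{s=1}^{t-1}(y_s-u\cdot x_s)^2+(u\cdot x_t)^2\Bigr\}.$$ 2. For all $T\ge1$, the set $\mathcal T\cap\{1,\ldots,T\}$ contains exactly $r_T$ rounds, and $\lambda_{r_t}(G_t)>0$ for each $t$ in it. 3. For all $T\ge1$, all $B$ and all $y_1,\ldots,y_T\in[-B,B]$, the uniform regret $\sup_{u\in\mathbb R^d}\mathcal R_T(u)$ is finite and $$\sup_{u\in\mathbb R^d}\mathcal R_T(u)\le B^2\sum_{t=1}^T x_t^{\mathsf T}G_t^\dagger x_t\le B^2\sum_{k=1}^{r_T}\log\lambda_k(G_T)+B^2\sum_{t\in\mathcal T\cap\{1,\ldots,T\}}\log\frac1{\lambda_{r_t}(G_t)}+r_TB^2 .$$ 4. For all $T\ge1$, all $B$, all $X>0$ such that $\|x_t\|\le X$ for $1\le t\le T$, and all $y_1,\ldots,y_T\in[-B,B]$, $$\sup_{u\in\mathbb R^d}\mathcal R_T(u)\le dB^2\log T+dB^2+B^2\sum_{t\in\mathcal T\cap\{1,\ldots,T\}}\log\frac{X^2}{\lambda_{r_t}(G_t)}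 .$$ 5. Consequently, if the whole sequence $(x_t)_{t\ge1}$ is bounded, the uniform regret is at most $dB^2\log T+\mathcal O_T(1)$: there is a constant $C$, depending only on the sequence $(x_t)_{t\ge1}$, such that $\sup_{u\in\mathbb R^d}\mathcal R_T(u)\le dB^2\log T+CB^2$ for all $T\ge1$, all $B$ and all $y_1,\ldots,y_T\in[-B,B]$. -/

import Mathlib

open scoped Matrix

noncomputable section

namespace SeqRidge

/-- The four Penrose equations: `N` is the Moore-Penrose pseudoinverse of the real matrix `M`. -/
structure IsMoorePenrose {m n : Type*} [Fintype m] [Fintype n]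
    (M : Matrix m n ℝ) (N : Matrix n m ℝ) : Prop where
  mul_mul_self : M * N * M = M
  self_mul_mul : N * M * N = N
  symm_left : (M * N)ᵀ = M * N
  symm_right : (N * M)ᵀ = N * M

theorem IsMoorePenrose.unique {m n : Type*} [Fintype m] [Fintype n]
    {M : Matrix m n ℝ} {N N' : Matrix n m ℝ}
    (h : IsMoorePenrose M N) (h' : IsMoorePenrose M N') : N = N' := by
  have e1 : M * N = M * N' := by
    calc M * N = (M * N)ᵀ := h.symm_left.symm
      _ = ((M * N') * (M * N))ᵀ := by rw [← Matrix.mul_assoc, h'.mul_mul_self]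
      _ = (M * N) * (M * N') := by rw [Matrix.transpose_mul, h.symm_left, h'.symm_left]
      _ = M * N' := by rw [← Matrix.mul_assoc, h.mul_mul_self]
  have e2 : N * M = N' * M := by
    calc N * M = (N * M)ᵀ := h.symm_right.symm
      _ = ((N * M) * (N' * M))ᵀ := by
        rw [Matrix.mul_assoc, ← Matrix.mul_assoc M, h'.mul_mul_self]
      _ = (N' * M) * (N * M) := by rw [Matrix.transpose_mul, h.symm_right, h'.symm_right]
      _ = N' * M := by rw [Matrix.mul_assoc, ← Matrix.mul_assoc M, h.mul_mul_self]
  calc N = N * (M * N) := by rw [← Matrix.mul_assoc, h.self_mul_mul]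
    _ = N' * M * N' := by rw [e1, ← Matrix.mul_assoc, e2]
    _ = N' := h'.self_mul_mul

theorem IsMoorePenrose.transpose {m n : Type*} [Fintype m] [Fintype n]
    {M : Matrix m n ℝ} {N : Matrix n m ℝ} (h : IsMoorePenrose M N) : IsMoorePenrose Mᵀ Nᵀ where
  mul_mul_self := by
    rw [← Matrix.transpose_mul, ← Matrix.transpose_mul, ← Matrix.mul_assoc, h.mul_mul_self]
  self_mul_mul := by
    rw [← Matrix.transpose_mul, ← Matrix.transpose_mul, ← Matrix.mul_assoc, h.self_mul_mul]
  symm_left := by rw [← Matrix.transpose_mul, h.symm_right, h.symm_right]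
  symm_right := by rw [← Matrix.transpose_mul, h.symm_left, h.symm_left]

theorem exists_isMoorePenrose_of_isHermitian {n : Type*} [Fintype n] [DecidableEq n]
    {A : Matrix n n ℝ} (hA : A.IsHermitian) : ∃ N, IsMoorePenrose A N := by
  obtain ⟨U, D, hU, hAD⟩ : ∃ (U : Matrix n n ℝ) (D : n → ℝ),
      Uᵀ * U = 1 ∧ A = U * Matrix.diagonal D * Uᵀ := by
    refine ⟨(hA.eigenvectorUnitary : Matrix n n ℝ), hA.eigenvalues, ?_, ?_⟩
    · have := Matrix.UnitaryGroup.star_mul_self hA.eigenvectorUnitary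
      simpa [Matrix.star_eq_conjTranspose, Matrix.conjTranspose_eq_transpose_of_trivial] using this
    · have := hA.spectral_theorem
      rw [Unitary.conjStarAlgAut_apply] at this
      simpa [Matrix.star_eq_conjTranspose, Matrix.conjTranspose_eq_transpose_of_trivial,
        Function.comp_def] using this
  have key : ∀ (P Q : Matrix n n ℝ), (U * P * Uᵀ) * (U * Q * Uᵀ) = U * (P * Q) * Uᵀ := by
    intro P Q
    calc (U * P * Uᵀ) * (U * Q * Uᵀ) = U * P * (Uᵀ * U) * Q * Uᵀ := by
          simp only [Matrix.mul_assoc]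
      _ = U * (P * Q) * Uᵀ := by rw [hU, Matrix.mul_one]; simp only [Matrix.mul_assoc]
  refine ⟨U * Matrix.diagonal (fun i => (D i)⁻¹) * Uᵀ, ?_, ?_, ?_, ?_⟩
  · rw [hAD, key, key]
    simp only [Matrix.diagonal_mul_diagonal, mul_inv_mul_cancel]
  · rw [hAD, key, key]
    have : ∀ a : ℝ, a⁻¹ * a * a⁻¹ = a⁻¹ := fun a => by
      by_cases h : a = 0 <;> simp [h]
    simp only [Matrix.diagonal_mul_diagonal, this]
  · rw [hAD, key]
    simp only [Matrix.diagonal_mul_diagonal, Matrix.transpose_mul, Matrix.transpose_transpose,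
      Matrix.diagonal_transpose, Matrix.mul_assoc]
  · rw [hAD, key]
    simp only [Matrix.diagonal_mul_diagonal, Matrix.transpose_mul, Matrix.transpose_transpose,
      Matrix.diagonal_transpose, Matrix.mul_assoc]

theorem exists_isMoorePenrose {m n : Type*} [Fintype m] [Fintype n]
    (M : Matrix m n ℝ) : ∃ N, IsMoorePenrose M N := by
  classical
  have hH : (Mᵀ * M).IsHermitian := by
    rw [← Matrix.conjTranspose_eq_transpose_of_trivial]
    exact Matrix.isHermitian_conjTranspose_mul_self M
  obtain ⟨P, h⟩ := exists_isMoorePenrose_of_isHermitian hH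
  have hsym : Pᵀ = P :=
    IsMoorePenrose.unique (M := (Mᵀ * M)ᵀ) h.transpose
      (by rwa [Matrix.transpose_mul, Matrix.transpose_transpose])
  have hM : M * P * (Mᵀ * M) = M := by
    have hz : (M * P * (Mᵀ * M) - M)ᴴ * (M * P * (Mᵀ * M) - M) = 0 := by
      have e : Mᵀ * (M * P * (Mᵀ * M) - M) = 0 := by
        rw [Matrix.mul_sub, sub_eq_zero, ← h.mul_mul_self]
        simp only [Matrix.mul_assoc]
        have := h.mul_mul_self
        simp only [Matrix.mul_assoc] at this
        simp only [this]
      have f : (M * P * (Mᵀ * M) - M)ᴴ = (Mᵀ * M * P - 1) * Mᵀ := by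
        rw [Matrix.conjTranspose_eq_transpose_of_trivial]
        simp [Matrix.transpose_mul, Matrix.sub_mul, Matrix.mul_assoc, hsym]
      rw [f, Matrix.mul_assoc, e, Matrix.mul_zero]
    exact sub_eq_zero.mp (Matrix.conjTranspose_mul_self_eq_zero.mp hz)
  refine ⟨P * Mᵀ, ?_, ?_, ?_, ?_⟩
  · simpa only [Matrix.mul_assoc] using hM
  · have := h.self_mul_mul
    calc P * Mᵀ * M * (P * Mᵀ) = (P * (Mᵀ * M) * P) * Mᵀ := by simp only [Matrix.mul_assoc]
      _ = P * Mᵀ := by rw [this]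
  · simp [Matrix.transpose_mul, hsym, Matrix.mul_assoc]
  · have := h.symm_right
    simpa only [Matrix.mul_assoc] using this

/-- The Moore-Penrose pseudoinverse `M†` of a real matrix. -/
def pinv {m n : Type*} [Fintype m] [Fintype n] (M : Matrix m n ℝ) : Matrix n m ℝ :=
  (exists_isMoorePenrose M).choose

theorem pinv_spec {m n : Type*} [Fintype m] [Fintype n] (M : Matrix m n ℝ) :
    IsMoorePenrose M (pinv M) :=
  (exists_isMoorePenrose M).choose_spec

/-- The `k`-th largest eigenvalue (`k = 1, …, d`, counted with multiplicity) of a real symmetric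
`d × d` matrix. The value for other `k` is irrelevant and set to `0`. -/
def sortedEigenvalue {d : ℕ} {A : Matrix (Fin d) (Fin d) ℝ} (hA : A.IsHermitian) (k : ℕ) : ℝ :=
  if h : 1 ≤ k ∧ k ≤ d then
    hA.eigenvalues₀ ⟨k - 1, by rw [Fintype.card_fin]; omega⟩
  else 0

/-! Sequences of features and observations are indexed by the rounds `1, 2, …`; index `0` is
never used. -/

variable {d : ℕ}

/-- The Gram matrix `G_t = ∑_{s=1}^t x_s x_sᵀ`. -/
def gram (x : ℕ → EuclideanSpace ℝ (Fin d)) (t : ℕ) : Matrix (Fin d) (Fin d) ℝ :=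
  ∑ s ∈ Finset.Icc 1 t, Matrix.vecMulVec (x s).ofLp (x s).ofLp

theorem gram_isHermitian (x : ℕ → EuclideanSpace ℝ (Fin d)) (t : ℕ) :
    (gram x t).IsHermitian := by
  unfold Matrix.IsHermitian gram
  rw [Matrix.conjTranspose_sum]
  refine Finset.sum_congr rfl fun s _ => ?_
  ext i j
  simp [Matrix.vecMulVec_apply, mul_comm]

/-- `λ_k(G_t)`, the `k`-th largest eigenvalue of the Gram matrix. -/
def gramEigenvalue (x : ℕ → EuclideanSpace ℝ (Fin d)) (t k : ℕ) : ℝ :=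
  sortedEigenvalue (gram_isHermitian x t) k

/-- `r_t = rank(G_t)`. -/
def gramRank (x : ℕ → EuclideanSpace ℝ (Fin d)) (t : ℕ) : ℕ := (gram x t).rank

/-- `b_t = ∑_{s=1}^t y_s x_s`. -/
def bvec (x : ℕ → EuclideanSpace ℝ (Fin d)) (y : ℕ → ℝ) (t : ℕ) : EuclideanSpace ℝ (Fin d) :=
  ∑ s ∈ Finset.Icc 1 t, y s • x s

/-- The weights `û_t = G_t† b_{t-1}` of non-linear ridge regression with `λ = 0` (`t ≥ 1`). -/
def ridgeWeights (x : ℕ → EuclideanSpace ℝ (Fin d)) (y : ℕ → ℝ) (t : ℕ) :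
    EuclideanSpace ℝ (Fin d) :=
  WithLp.toLp 2 (pinv (gram x t) *ᵥ (bvec x y (t - 1)).ofLp)

/-- The objective `∑_{s=1}^{t-1} (y_s - u·x_s)² + (u·x_t)²` of round `t`. -/
def ridgeObjective (x : ℕ → EuclideanSpace ℝ (Fin d)) (y : ℕ → ℝ) (t : ℕ)
    (u : EuclideanSpace ℝ (Fin d)) : ℝ :=
  ∑ s ∈ Finset.Icc 1 (t - 1), (y s - inner ℝ u (x s)) ^ 2 + (inner ℝ u (x t)) ^ 2

/-- The regret `R_T(u)` against `u`, after `T` rounds, of the forecaster that predicts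
`ŷ_t = û_t · x_t`. -/
def regret (uhat x : ℕ → EuclideanSpace ℝ (Fin d)) (y : ℕ → ℝ) (T : ℕ)
    (u : EuclideanSpace ℝ (Fin d)) : ℝ :=
  ∑ t ∈ Finset.Icc 1 T, (y t - inner ℝ (uhat t) (x t)) ^ 2
    - ∑ t ∈ Finset.Icc 1 T, (y t - inner ℝ u (x t)) ^ 2

/-- The quadratic form `x_tᵀ G_t† x_t`. -/
def leverage (x : ℕ → EuclideanSpace ℝ (Fin d)) (t : ℕ) : ℝ :=
  (x t).ofLp ⬝ᵥ (pinv (gram x t) *ᵥ (x t).ofLp)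

/-- The set of rounds at which the rank of the Gram matrix increases: the first round with a
non-null feature vector, and all `s ≥ 2` with `rank(G_{s-1}) ≠ rank(G_s)`. -/
def rankRounds (x : ℕ → EuclideanSpace ℝ (Fin d)) : Set ℕ :=
  {s | IsLeast {t | 1 ≤ t ∧ x t ≠ 0} s} ∪ {s | 2 ≤ s ∧ gramRank x (s - 1) ≠ gramRank x s}

open Classical in
/-- The rounds of `{1, …, T}` at which the rank increases. -/
def rankRoundsUpTo (x : ℕ → EuclideanSpace ℝ (Fin d)) (T : ℕ) : Finset ℕ :=
  (Finset.Icc 1 T).filter (fun s => s ∈ rankRounds x)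

end SeqRidge

end

namespace SeqRidge

open Matrix

/-! Regret. Completing the square, the comparator loss is at least `∑ y_t² - Φ_T`, where `Φ_t = b_tᵀ
G_t† b_t`. With `p_t` the forecast and `ℓ_t` the leverage, `Φ_t = b_{t-1}ᵀ G_t† b_{t-1} + 2 y_t p_t
+ y_t² ℓ_t`, and `pinv_potential_step` gives `b_{t-1}ᵀ G_t† b_{t-1} + p_t² ≤ Φ_{t-1}`. Hence `(y_t -
p_t)² ≤ y_t² - (Φ_t - Φ_{t-1}) + y_t² ℓ_t`; telescoping leaves a regret of at most `∑ y_t² ℓ_t`.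

Leverages. If the rank is unchanged, the pseudo-determinant satisfies `pdet G_{t-1} = pdet G_t * (1
- ℓ_t)`, so `ℓ_t ≤ log pdet G_t - log pdet G_{t-1}`. If the rank grows, it grows by one, `ℓ_t ≤ 1`,
and by Weyl's monotonicity (`sortedEigenvalue_mono`) `log pdet` increases by at least the log of the
smallest positive eigenvalue of `G_t`. Summing gives `sum_leverage_le`.

For bounded features the eigenvalues are at most the trace, hence at most `T X²`. The rank is at
most `d`, so the rank rounds eventually stop and the remainder stays bounded. -/

theorem _root_.Matrix.PosSemidef.transpose_eq {n : Type*} {A : Matrix n n ℝ} (hA : A.PosSemidef) :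
    Aᵀ = A := by
  have := hA.isHermitian
  rwa [IsHermitian, conjTranspose_eq_transpose_of_trivial] at this

/-! ### Pseudoinverses under rank-one updates of positive semidefinite matrices. -/

section Pinv

variable {n : Type*} [Fintype n]

theorem pinv_transpose_of_symm {A : Matrix n n ℝ} (hA : Aᵀ = A) : (pinv A)ᵀ = pinv A := by
  have h := (pinv_spec A).transpose
  rw [hA] at h
  exact h.unique (pinv_spec A)

theorem mul_pinv_comm {A : Matrix n n ℝ} (hA : Aᵀ = A) : A * pinv A = pinv A * A := by
  rw [← (pinv_spec A).symm_left, transpose_mul, hA, pinv_transpose_of_symm hA]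

theorem dotProduct_mulVec_comm {A : Matrix n n ℝ} (hA : Aᵀ = A) (v w : n → ℝ) :
    v ⬝ᵥ A *ᵥ w = w ⬝ᵥ A *ᵥ v := by
  rw [dotProduct_mulVec, ← mulVec_transpose, hA, dotProduct_comm]

theorem _root_.Matrix.PosSemidef.real_nonneg {A : Matrix n n ℝ} (hA : A.PosSemidef) (v : n → ℝ) :
    0 ≤ v ⬝ᵥ A *ᵥ v := by
  simpa using hA.dotProduct_mulVec_nonneg v

theorem posSemidef_vecMulVec_self (x : n → ℝ) : (vecMulVec x x).PosSemidef := by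
  simpa using posSemidef_vecMulVec_self_star x

theorem vecMulVec_self_mulVec (x v : n → ℝ) : vecMulVec x x *ᵥ v = (x ⬝ᵥ v) • x := by
  rw [vecMulVec_mulVec, op_smul_eq_smul]

theorem dotProduct_add_vecMulVec_mulVec (A : Matrix n n ℝ) (x v : n → ℝ) :
    v ⬝ᵥ (A + vecMulVec x x) *ᵥ v = v ⬝ᵥ A *ᵥ v + (x ⬝ᵥ v) ^ 2 := by
  rw [add_mulVec, vecMulVec_self_mulVec, dotProduct_add, dotProduct_smul, smul_eq_mul,
    dotProduct_comm v x, sq]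

/-- `B† B v - v` lies in the kernel of `B`, hence is killed by `A`. -/
theorem mul_eq_self_of_ker_le [DecidableEq n] {A B : Matrix n n ℝ}
    (h : ∀ v, B *ᵥ v = 0 → A *ᵥ v = 0) : A * (pinv B * B) = A := by
  refine ext_iff_mulVec.mpr fun v => ?_
  have := h (pinv B *ᵥ B *ᵥ v - v) (by
    simp only [mulVec_sub, mulVec_mulVec]
    rw [← Matrix.mul_assoc, (pinv_spec B).mul_mul_self, sub_self])
  rw [mulVec_sub, sub_eq_zero] at this
  simpa only [mulVec_mulVec] using this

variable {A : Matrix n n ℝ} {x : n → ℝ}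

theorem mulVec_eq_zero_of_add_vecMulVec (hA : A.PosSemidef) {v : n → ℝ}
    (hv : (A + vecMulVec x x) *ᵥ v = 0) : A *ᵥ v = 0 ∧ x ⬝ᵥ v = 0 := by
  have h := dotProduct_add_vecMulVec_mulVec A x v
  rw [hv, dotProduct_zero] at h
  have h1 := hA.real_nonneg v
  have h2 : (x ⬝ᵥ v) ^ 2 = 0 := by nlinarith [sq_nonneg (x ⬝ᵥ v)]
  have h3 : v ⬝ᵥ A *ᵥ v = 0 := by nlinarith [sq_nonneg (x ⬝ᵥ v)]
  exact ⟨(hA.dotProduct_mulVec_zero_iff v).mp (by simpa using h3), by simpa using h2⟩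

theorem add_vecMulVec_posSemidef (hA : A.PosSemidef) (x : n → ℝ) :
    (A + vecMulVec x x).PosSemidef :=
  hA.add (posSemidef_vecMulVec_self x)

theorem mul_pinv_add_vecMulVec [DecidableEq n] (hA : A.PosSemidef) :
    A * (pinv (A + vecMulVec x x) * (A + vecMulVec x x)) = A :=
  mul_eq_self_of_ker_le fun _ hv => (mulVec_eq_zero_of_add_vecMulVec hA hv).1

/-- The range can only grow: with `B = A + x xᵀ`, transposing `A B† B = A` gives `B B† A = A`, and
`hb` says that `b` is in the range of `A`. -/
theorem mul_pinv_mulVec_of_range [DecidableEq n] (hA : A.PosSemidef) {b : n → ℝ}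
    (hb : A *ᵥ pinv A *ᵥ b = b) :
    (A + vecMulVec x x) *ᵥ pinv (A + vecMulVec x x) *ᵥ b = b := by
  have h := congrArg transpose (mul_pinv_add_vecMulVec (x := x) hA)
  rw [transpose_mul, (pinv_spec _).symm_right,
    ← mul_pinv_comm (add_vecMulVec_posSemidef hA x).transpose_eq, hA.transpose_eq] at h
  conv_lhs => rw [← hb]
  rw [mulVec_mulVec, mulVec_mulVec, h, hb]

/-- The kernel of the updated matrix is orthogonal to `x`, so `x` lies in its range. -/
theorem mul_pinv_mulVec_update [DecidableEq n] (hA : A.PosSemidef) :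
    (A + vecMulVec x x) *ᵥ pinv (A + vecMulVec x x) *ᵥ x = x := by
  set B := A + vecMulVec x x with hB
  have hBs : Bᵀ = B := (add_vecMulVec_posSemidef hA x).transpose_eq
  refine dotProduct_eq _ _ fun w => ?_
  have h := (mulVec_eq_zero_of_add_vecMulVec (x := x) hA (v := pinv B *ᵥ B *ᵥ w - w) (by
    simp only [mulVec_sub, mulVec_mulVec, ← hB]
    rw [← Matrix.mul_assoc, (pinv_spec B).mul_mul_self, sub_self])).2
  rw [dotProduct_sub, sub_eq_zero] at h
  rw [← h, mulVec_mulVec, mulVec_mulVec, dotProduct_comm, mul_pinv_comm hBs,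
    dotProduct_mulVec_comm (pinv_spec B).symm_right]

/-- The leverage of the last rank-one update satisfies `ℓ² ≤ ℓ`. -/
theorem leverage_sq_le [DecidableEq n] (hA : A.PosSemidef) :
    (x ⬝ᵥ pinv (A + vecMulVec x x) *ᵥ x) ^ 2 ≤ x ⬝ᵥ pinv (A + vecMulVec x x) *ᵥ x := by
  have h := dotProduct_add_vecMulVec_mulVec A x (pinv (A + vecMulVec x x) *ᵥ x)
  rw [mul_pinv_mulVec_update hA, dotProduct_comm _ x] at h
  have := hA.real_nonneg (pinv (A + vecMulVec x x) *ᵥ x)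
  linarith

/-- Decrease of the potential `bᵀ A† b` under a rank-one update. -/
theorem pinv_potential_step [DecidableEq n] (hA : A.PosSemidef) {b : n → ℝ}
    (hb : A *ᵥ pinv A *ᵥ b = b) :
    b ⬝ᵥ pinv (A + vecMulVec x x) *ᵥ b + (x ⬝ᵥ pinv (A + vecMulVec x x) *ᵥ b) ^ 2
      ≤ b ⬝ᵥ pinv A *ᵥ b := by
  have hl := leverage_sq_le (x := x) hA
  have hBb := mul_pinv_mulVec_of_range (x := x) hA hb
  have hBx := mul_pinv_mulVec_update (x := x) hA
  have hBs := (add_vecMulVec_posSemidef hA x).transpose_eq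
  set w := pinv A *ᵥ b
  have hw : (A + vecMulVec x x) *ᵥ w = b + (x ⬝ᵥ w) • x := by
    rw [add_mulVec, vecMulVec_self_mulVec, hb]
  set B := A + vecMulVec x x
  have hPs := pinv_transpose_of_symm hBs
  -- For `v` in the range of `B`, `v · w = (B† v) · (B w)`, and `B w = b + c x` with `c = x · w`.
  have key : ∀ v, B *ᵥ pinv B *ᵥ v = v →
      v ⬝ᵥ w = v ⬝ᵥ pinv B *ᵥ b + (x ⬝ᵥ w) * (v ⬝ᵥ pinv B *ᵥ x) := by
    intro v hv
    rw [← smul_eq_mul, ← dotProduct_smul, ← dotProduct_add, ← mulVec_smul, ← mulVec_add, ← hw,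
      dotProduct_mulVec_comm hPs, dotProduct_comm (B *ᵥ w), dotProduct_mulVec_comm hBs, hv,
      dotProduct_comm]
  have h1 := key b hBb
  have h2 := key x hBx
  rw [dotProduct_mulVec_comm hPs b x] at h1
  set c := x ⬝ᵥ w
  set l := x ⬝ᵥ pinv B *ᵥ x
  -- The claim becomes `c² (1 - l)² ≤ c² (1 - l)`, that is `c² (l - l²) ≥ 0`. Nothing is divided by
  -- `1 - l`, so a rank increase needs no separate case.
  have h3 : x ⬝ᵥ pinv B *ᵥ b = c * (1 - l) := by linarith
  rw [h3] at h1 ⊢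
  nlinarith [mul_nonneg (sq_nonneg c) (sub_nonneg.mpr hl)]

theorem rank_le_rank_add_vecMulVec [DecidableEq n] (hA : A.PosSemidef) :
    A.rank ≤ (A + vecMulVec x x).rank := by
  conv_lhs => rw [← mul_pinv_add_vecMulVec (x := x) hA]
  exact (rank_mul_le_right _ _).trans (rank_mul_le_right _ _)

theorem rank_add_vecMulVec_le (A : Matrix n n ℝ) (x : n → ℝ) :
    (A + vecMulVec x x).rank ≤ A.rank + 1 := by
  have h : (A + vecMulVec x x).rank ≤ A.rank + (vecMulVec x x).rank := by
    unfold Matrix.rank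
    rw [mulVecLin_add]
    refine (Submodule.finrank_mono ?_).trans (Submodule.finrank_add_le_finrank_add_finrank _ _)
    rintro _ ⟨v, rfl⟩
    exact Submodule.add_mem_sup ⟨v, rfl⟩ ⟨v, rfl⟩
  exact h.trans (Nat.add_le_add_left (rank_vecMulVec_le x x) _)

theorem ker_eq_of_ker_le_of_rank_eq {M N : Matrix n n ℝ} (h : ∀ v, M *ᵥ v = 0 → N *ᵥ v = 0)
    (hr : N.rank = M.rank) {v : n → ℝ} (hv : N *ᵥ v = 0) : M *ᵥ v = 0 := by
  have h1 := LinearMap.finrank_range_add_finrank_ker M.mulVecLin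
  have h2 := LinearMap.finrank_range_add_finrank_ker N.mulVecLin
  unfold Matrix.rank at hr
  have : M.mulVecLin.ker = N.mulVecLin.ker :=
    Submodule.eq_of_le_of_finrank_eq (fun v hv => by simpa using h v (by simpa using hv))
      (by omega)
  have hm : v ∈ M.mulVecLin.ker := by rw [this]; simpa using hv
  simpa using hm

/-- Equal ranks turn the inclusion of kernels into an equality, and `A† A`, `B† B` are the
orthogonal projections along these kernels. -/
theorem pinv_mul_self_eq_of_rank_eq [DecidableEq n] {B : Matrix n n ℝ}
    (h : ∀ v, B *ᵥ v = 0 → A *ᵥ v = 0) (hr : A.rank = B.rank) :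
    pinv A * A = pinv B * B := by
  have h1 := mul_eq_self_of_ker_le h
  have h2 : B * (pinv A * A) = B :=
    mul_eq_self_of_ker_le fun v hv => ker_eq_of_ker_le_of_rank_eq h hr hv
  calc pinv A * A = (pinv A * A) * (pinv B * B) := by
        rw [Matrix.mul_assoc, h1]
    _ = ((pinv B * B) * (pinv A * A))ᵀ := by
        rw [transpose_mul, (pinv_spec A).symm_right, (pinv_spec B).symm_right]
    _ = (pinv B * B)ᵀ := by rw [Matrix.mul_assoc, h2]
    _ = pinv B * B := (pinv_spec B).symm_right

/-- The pseudo-determinant of a symmetric matrix: the product of its nonzero eigenvalues. -/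
noncomputable def pdet [DecidableEq n] (A : Matrix n n ℝ) : ℝ := (A + 1 - pinv A * A).det

/-- With `B` the updated matrix and `Q = B† B`, which equals `A† A`, the identity `(B + 1 - Q) B† x
= x` gives `A + 1 - Q = (B + 1 - Q)(1 - B† x xᵀ)`. The matrix determinant lemma concludes. -/
theorem pdet_eq_of_rank_eq [DecidableEq n] (hA : A.PosSemidef)
    (hr : A.rank = (A + vecMulVec x x).rank) :
    pdet A = pdet (A + vecMulVec x x) * (1 - x ⬝ᵥ pinv (A + vecMulVec x x) *ᵥ x) := by
  have hQ := pinv_mul_self_eq_of_rank_eq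
    (fun _ hv => (mulVec_eq_zero_of_add_vecMulVec hA hv).1) hr
  have hx := mul_pinv_mulVec_update (x := x) hA
  have hA' : A = (A + vecMulVec x x) - vecMulVec x x := by simp
  unfold pdet
  rw [hQ]
  generalize A + vecMulVec x x = B at *
  have hBx : (B + 1 - pinv B * B) *ᵥ pinv B *ᵥ x = x := by
    rw [sub_mulVec, add_mulVec, hx, one_mulVec, mulVec_mulVec, (pinv_spec B).self_mul_mul]
    simp
  have h : A + 1 - pinv B * B
      = (B + 1 - pinv B * B) * (1 - vecMulVec (pinv B *ᵥ x) x) := by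
    rw [Matrix.mul_sub, Matrix.mul_one, mul_vecMulVec, hBx, hA']
    abel
  rw [h, det_mul, vecMulVec_eq Unit, det_one_sub_mul_comm]
  simp [replicateRow_mul_replicateCol_apply, det_unique]

end Pinv

/-! ### Sorted eigenvalues, Weyl's monotonicity and the pseudo-determinant. -/

section Eigenvalues

variable {d : ℕ} {A B : Matrix (Fin d) (Fin d) ℝ}

theorem sortedEigenvalue_antitone (hA : A.IsHermitian) {i j : Fin d} (hij : i ≤ j) :
    sortedEigenvalue hA (j + 1) ≤ sortedEigenvalue hA (i + 1) := by
  unfold sortedEigenvalue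
  rw [dif_pos (by omega), dif_pos (by omega)]
  exact hA.eigenvalues₀_antitone (Fin.mk_le_mk.mpr (by
    have := Fin.le_def.mp hij; omega))

theorem exists_sorted_diagonalization (hA : A.IsHermitian) :
    ∃ U : Matrix (Fin d) (Fin d) ℝ, Uᵀ * U = 1 ∧ U * Uᵀ = 1 ∧
      A = U * diagonal (fun i : Fin d => sortedEigenvalue hA (i + 1)) * Uᵀ := by
  set V := (hA.eigenvectorUnitary : Matrix (Fin d) (Fin d) ℝ) with hV
  have h1 : Vᵀ * V = 1 := by
    have := Matrix.UnitaryGroup.star_mul_self hA.eigenvectorUnitary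
    simpa [Matrix.star_eq_conjTranspose, Matrix.conjTranspose_eq_transpose_of_trivial] using this
  have hAD : A = V * diagonal hA.eigenvalues * Vᵀ := by
    have := hA.spectral_theorem
    rw [Unitary.conjStarAlgAut_apply] at this
    simpa [Matrix.star_eq_conjTranspose, Matrix.conjTranspose_eq_transpose_of_trivial,
      Function.comp_def] using this
  -- `eigenvalues` is indexed through an unspecified bijection; `σ` undoes it, so that permuting the
  -- eigenvectors sorts the diagonal.
  let σ : Fin d ≃ Fin d := (finCongr (Fintype.card_fin d).symm).trans
    (Fintype.equivOfCardEq (Fintype.card_fin _))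
  have hσ : ∀ i : Fin d, hA.eigenvalues (σ i) = sortedEigenvalue hA (i + 1) := by
    intro i
    unfold sortedEigenvalue Matrix.IsHermitian.eigenvalues
    rw [dif_pos (by omega)]
    congr 1
    simp only [σ, Equiv.trans_apply, Equiv.symm_apply_apply]
    ext
    simp
  refine ⟨V.submatrix id σ, ?_, ?_, ?_⟩
  · rw [transpose_submatrix, ← submatrix_mul _ _ _ _ _ Function.bijective_id, h1,
      submatrix_one_equiv]
  · rw [transpose_submatrix, submatrix_mul_equiv, mul_eq_one_comm.mp h1, submatrix_id_id]
  · have : diagonal (fun i : Fin d => sortedEigenvalue hA (i + 1))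
        = (diagonal hA.eigenvalues).submatrix σ σ := by
      rw [submatrix_diagonal_equiv]
      congr 1
      ext i
      exact (hσ i).symm
    rw [this, transpose_submatrix, submatrix_mul_equiv, submatrix_mul_equiv, submatrix_id_id]
    exact hAD

theorem dotProduct_conj_diagonal (U : Matrix (Fin d) (Fin d) ℝ) (D v : Fin d → ℝ) :
    v ⬝ᵥ (U * diagonal D * Uᵀ) *ᵥ v = ∑ i, D i * ((Uᵀ *ᵥ v) i) ^ 2 := by
  rw [← mulVec_mulVec, ← mulVec_mulVec, dotProduct_mulVec, ← mulVec_transpose]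
  simp only [dotProduct, mulVec_diagonal]
  exact Finset.sum_congr rfl fun i _ => by ring

theorem sum_sq_transpose_mulVec {U : Matrix (Fin d) (Fin d) ℝ} (hU : U * Uᵀ = 1)
    (v : Fin d → ℝ) : ∑ i, ((Uᵀ *ᵥ v) i) ^ 2 = v ⬝ᵥ v := by
  have := dotProduct_conj_diagonal U 1 v
  simpa [hU] using this.symm

/-- Weyl's monotonicity: the sorted eigenvalues are monotone for the Loewner order. -/
theorem sortedEigenvalue_mono (hA : A.IsHermitian) (hB : B.IsHermitian)
    (h : ∀ v, v ⬝ᵥ A *ᵥ v ≤ v ⬝ᵥ B *ᵥ v) (k : ℕ) :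
    sortedEigenvalue hA k ≤ sortedEigenvalue hB k := by
  by_cases hk : 1 ≤ k ∧ k ≤ d
  swap
  · simp [sortedEigenvalue, hk]
  obtain ⟨k, rfl⟩ : ∃ i : Fin d, k = i + 1 := ⟨⟨k - 1, by omega⟩, by simp; omega⟩
  obtain ⟨U, -, hU, hAU⟩ := exists_sorted_diagonalization hA
  obtain ⟨V, -, hV, hBV⟩ := exists_sorted_diagonalization hB
  -- Courant–Fischer dimension count: the `d - 1` conditions "no component on eigenvectors of `A`
  -- after `k`, nor on those of `B` before `k`" leave a nonzero `v`, whose Rayleigh quotients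
  -- separate the two eigenvalues.
  let f : (Fin d → ℝ) →ₗ[ℝ] ({j : Fin d // j ≠ k} → ℝ) :=
    LinearMap.pi fun j => if k < j.1 then LinearMap.proj j.1 ∘ₗ Uᵀ.mulVecLin
      else LinearMap.proj j.1 ∘ₗ Vᵀ.mulVecLin
  have hf : LinearMap.ker f ≠ ⊥ := by
    refine LinearMap.ker_ne_bot_of_finrank_lt ?_
    rw [Module.finrank_fintype_fun_eq_card, Module.finrank_fintype_fun_eq_card]
    exact Fintype.card_subtype_lt (x := k) (by simp)
  obtain ⟨v, hv, hv0⟩ := Submodule.exists_mem_ne_zero_of_ne_bot hf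
  have hlo : ∀ j, k < j → (Uᵀ *ᵥ v) j = 0 := by
    intro j hj
    have := congrFun (LinearMap.mem_ker.mp hv) ⟨j, hj.ne'⟩
    simpa [f, hj, ← mulVec_transpose] using this
  have hhi : ∀ j, j < k → (Vᵀ *ᵥ v) j = 0 := by
    intro j hj
    have := congrFun (LinearMap.mem_ker.mp hv) ⟨j, hj.ne⟩
    simpa [f, hj.le.not_gt, ← mulVec_transpose] using this
  have hpos : 0 < v ⬝ᵥ v := by
    simpa using dotProduct_star_self_pos_iff.mpr hv0
  refine le_of_mul_le_mul_right ?_ hpos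
  calc sortedEigenvalue hA (k + 1) * (v ⬝ᵥ v)
      = ∑ i, sortedEigenvalue hA (k + 1) * ((Uᵀ *ᵥ v) i) ^ 2 := by
        rw [← Finset.mul_sum, sum_sq_transpose_mulVec hU]
    _ ≤ ∑ i : Fin d, sortedEigenvalue hA (i + 1) * ((Uᵀ *ᵥ v) i) ^ 2 := by
        refine Finset.sum_le_sum fun i _ => ?_
        rcases lt_or_ge k i with hi | hi
        · simp [hlo i hi]
        · exact mul_le_mul_of_nonneg_right (sortedEigenvalue_antitone hA hi) (sq_nonneg _)
    _ = v ⬝ᵥ A *ᵥ v := by rw [← dotProduct_conj_diagonal, ← hAU]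
    _ ≤ v ⬝ᵥ B *ᵥ v := h v
    _ = ∑ i : Fin d, sortedEigenvalue hB (i + 1) * ((Vᵀ *ᵥ v) i) ^ 2 := by
        rw [← dotProduct_conj_diagonal, ← hBV]
    _ ≤ ∑ i, sortedEigenvalue hB (k + 1) * ((Vᵀ *ᵥ v) i) ^ 2 := by
        refine Finset.sum_le_sum fun i _ => ?_
        rcases lt_or_ge i k with hi | hi
        · simp [hhi i hi]
        · exact mul_le_mul_of_nonneg_right (sortedEigenvalue_antitone hB hi) (sq_nonneg _)
    _ = sortedEigenvalue hB (k + 1) * (v ⬝ᵥ v) := by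
        rw [← Finset.mul_sum, sum_sq_transpose_mulVec hV]

theorem sortedEigenvalue_nonneg (hA : A.PosSemidef) (k : ℕ) :
    0 ≤ sortedEigenvalue hA.isHermitian k := by
  have h0 : (0 : Matrix (Fin d) (Fin d) ℝ).IsHermitian := isHermitian_zero
  have h1 := sortedEigenvalue_mono h0 hA.isHermitian (by simpa using hA.real_nonneg) k
  refine le_trans ?_ h1
  unfold sortedEigenvalue
  split_ifs with h
  · have := (isHermitian_zero (n := Fin d) (α := ℝ)).eigenvalues_eq_zero_iff.mpr rfl
    have h2 := congrFun this (Fintype.equivOfCardEq (Fintype.card_fin _)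
      (⟨k - 1, by rw [Fintype.card_fin]; omega⟩ : Fin (Fintype.card (Fin d))))
    simp only [IsHermitian.eigenvalues, Equiv.symm_apply_apply] at h2
    exact h2.ge
  · exact le_rfl

theorem rank_eq_card_sortedEigenvalue (hA : A.IsHermitian) :
    A.rank = Fintype.card {i : Fin d // sortedEigenvalue hA (i + 1) ≠ 0} := by
  obtain ⟨U, h1, h2, hAU⟩ := exists_sorted_diagonalization hA
  have hu : IsUnit U.det := (isUnit_iff_isUnit_det U).mp (IsUnit.of_mul_eq_one _ h2)
  conv_lhs => rw [hAU]
  rw [← rank_diagonal, rank_mul_eq_left_of_isUnit_det Uᵀ _ (by rwa [det_transpose]),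
    rank_mul_eq_right_of_isUnit_det U _ hu]

/-- The eigenvalues are nonnegative and decreasing, so the positive ones form an initial segment,
whose length is the rank. -/
theorem sortedEigenvalue_pos_iff (hA : A.PosSemidef) (i : Fin d) :
    0 < sortedEigenvalue hA.isHermitian (i + 1) ↔ i < A.rank := by
  have hr := rank_eq_card_sortedEigenvalue hA.isHermitian
  rw [Fintype.card_subtype] at hr
  constructor
  · intro h
    have : Finset.Iic i ⊆ Finset.univ.filter
        fun j : Fin d => sortedEigenvalue hA.isHermitian (j + 1) ≠ 0 := by
      intro j hj
      rw [Finset.mem_filter]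
      exact ⟨Finset.mem_univ _,
        (h.trans_le (sortedEigenvalue_antitone _ (Finset.mem_Iic.mp hj))).ne'⟩
    have := Finset.card_le_card this
    rw [Fin.card_Iic] at this
    omega
  · intro h
    by_contra hc
    have h0 := le_antisymm (not_lt.mp hc) (sortedEigenvalue_nonneg hA _)
    have : (Finset.univ.filter
        fun j : Fin d => sortedEigenvalue hA.isHermitian (j + 1) ≠ 0) ⊆ Finset.Iio i := by
      intro j hj
      rw [Finset.mem_filter] at hj
      rw [Finset.mem_Iio]
      by_contra hij
      exact hj.2 (le_antisymm (h0 ▸ sortedEigenvalue_antitone _ (not_lt.mp hij))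
        (sortedEigenvalue_nonneg hA _))
    have := Finset.card_le_card this
    rw [Fin.card_Iio] at this
    omega

theorem sortedEigenvalue_pos (hA : A.PosSemidef) {k : ℕ} (hk : 1 ≤ k) (hkr : k ≤ A.rank) :
    0 < sortedEigenvalue hA.isHermitian k := by
  have hd : A.rank ≤ d := by simpa using A.rank_le_card_width
  have := (sortedEigenvalue_pos_iff hA ⟨k - 1, by omega⟩).mpr (by simp; omega)
  simpa [Nat.sub_add_cancel hk] using this

theorem isMoorePenrose_conj_diagonal {U : Matrix (Fin d) (Fin d) ℝ} (hU : Uᵀ * U = 1)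
    (D : Fin d → ℝ) :
    IsMoorePenrose (U * diagonal D * Uᵀ) (U * diagonal (fun i => (D i)⁻¹) * Uᵀ) := by
  have key : ∀ P Q : Matrix (Fin d) (Fin d) ℝ,
      (U * P * Uᵀ) * (U * Q * Uᵀ) = U * (P * Q) * Uᵀ := by
    intro P Q
    calc (U * P * Uᵀ) * (U * Q * Uᵀ) = U * P * (Uᵀ * U) * Q * Uᵀ := by
          simp only [Matrix.mul_assoc]
      _ = U * (P * Q) * Uᵀ := by rw [hU, Matrix.mul_one]; simp only [Matrix.mul_assoc]
  have hinv : ∀ a : ℝ, a⁻¹ * a * a⁻¹ = a⁻¹ := fun a => by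
    by_cases h : a = 0 <;> simp [h]
  constructor <;> simp only [key, diagonal_mul_diagonal, mul_inv_mul_cancel, hinv]
  all_goals simp only [transpose_mul, transpose_transpose, diagonal_transpose, Matrix.mul_assoc]

/-- In an eigenbasis, adding the kernel projection `1 - A† A` replaces each zero eigenvalue by `1`.
-/
theorem pdet_eq_prod (hA : A.IsHermitian) :
    pdet A = ∏ i : Fin d, if sortedEigenvalue hA (i + 1) = 0 then 1
      else sortedEigenvalue hA (i + 1) := by
  obtain ⟨U, h1, h2, hAU⟩ := exists_sorted_diagonalization hA
  set D : Fin d → ℝ := fun i => sortedEigenvalue hA (i + 1) with hD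
  have hP : pinv A = U * diagonal (fun i => (D i)⁻¹) * Uᵀ :=
    (pinv_spec A).unique (hAU ▸ isMoorePenrose_conj_diagonal h1 D)
  have hQ : pinv A * A = U * diagonal (fun i => (D i)⁻¹ * D i) * Uᵀ := by
    calc pinv A * A = U * diagonal (fun i => (D i)⁻¹) * (Uᵀ * U) * diagonal D * Uᵀ := by
          rw [hP]; conv_lhs => rw [hAU]
          simp only [Matrix.mul_assoc]
      _ = _ := by rw [h1, Matrix.mul_one, Matrix.mul_assoc U, diagonal_mul_diagonal]
  have hM : A + 1 - pinv A * A
      = U * diagonal (fun i => D i + 1 - (D i)⁻¹ * D i) * Uᵀ := by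
    have : diagonal (fun i => D i + 1 - (D i)⁻¹ * D i)
        = diagonal D + 1 - diagonal (fun i => (D i)⁻¹ * D i) := by
      rw [← diagonal_one, diagonal_add, diagonal_sub]
    rw [this, Matrix.mul_sub, Matrix.mul_add, Matrix.sub_mul, Matrix.add_mul, Matrix.mul_one, h2,
      ← hQ, ← hAU]
  unfold pdet
  rw [hM, det_mul_comm, ← Matrix.mul_assoc, h1, Matrix.one_mul, det_diagonal]
  refine Finset.prod_congr rfl fun i _ => ?_
  by_cases h : D i = 0
  · rw [if_pos h, h]; simp
  · rw [if_neg h, inv_mul_cancel₀ h]; ring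

theorem pdet_pos (hA : A.PosSemidef) : 0 < pdet A := by
  rw [pdet_eq_prod hA.isHermitian]
  refine Finset.prod_pos fun i _ => ?_
  split_ifs with h
  · exact one_pos
  · exact lt_of_le_of_ne (sortedEigenvalue_nonneg hA _) (Ne.symm h)

theorem log_pdet (hA : A.PosSemidef) :
    Real.log (pdet A) = ∑ k ∈ Finset.Icc 1 A.rank,
      Real.log (sortedEigenvalue hA.isHermitian k) := by
  have hd : A.rank ≤ d := by simpa using A.rank_le_card_width
  rw [pdet_eq_prod hA.isHermitian, Real.log_prod (fun i _ => by split_ifs with h <;> simp [h])]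
  -- Since `Real.log 0 = 0 = Real.log 1`, the case distinction disappears under the logarithm.
  have h1 : ∀ i : Fin d, Real.log (if sortedEigenvalue hA.isHermitian (i + 1) = 0 then 1
      else sortedEigenvalue hA.isHermitian (i + 1))
      = Real.log (sortedEigenvalue hA.isHermitian (i + 1)) := by
    intro i
    split_ifs with h <;> simp [h]
  simp only [h1]
  rw [Fin.sum_univ_eq_sum_range (fun i => Real.log (sortedEigenvalue hA.isHermitian (i + 1))),
    ← Finset.sum_subset (Finset.range_mono hd), Finset.range_eq_Ico,
    Finset.sum_Ico_add' (fun i => Real.log (sortedEigenvalue hA.isHermitian i)) 0 A.rank 1]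
  · rfl
  · intro i hi hir
    rw [Finset.mem_range] at hi hir
    have := (sortedEigenvalue_pos_iff hA ⟨i, hi⟩).not.mpr hir
    rw [le_antisymm (not_lt.mp this) (sortedEigenvalue_nonneg hA _), Real.log_zero]

theorem sortedEigenvalue_le_trace (hA : A.PosSemidef) (k : ℕ) :
    sortedEigenvalue hA.isHermitian k ≤ A.trace := by
  by_cases hk : 1 ≤ k ∧ k ≤ d
  swap
  · simpa [sortedEigenvalue, hk] using hA.trace_nonneg
  obtain ⟨k, rfl⟩ : ∃ i : Fin d, k = i + 1 := ⟨⟨k - 1, by omega⟩, by simp; omega⟩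
  obtain ⟨U, h1, -, hAU⟩ := exists_sorted_diagonalization hA.isHermitian
  have : A.trace = ∑ i : Fin d, sortedEigenvalue hA.isHermitian (i + 1) := by
    conv_lhs => rw [hAU, trace_mul_comm, ← Matrix.mul_assoc, h1, Matrix.one_mul, trace_diagonal]
  rw [this]
  exact Finset.single_le_sum (f := fun i : Fin d => sortedEigenvalue hA.isHermitian (i + 1))
    (fun i _ => sortedEigenvalue_nonneg hA _) (Finset.mem_univ k)

end Eigenvalues

/-! ### Gram matrices, weights and regret. -/

section Gram

variable {d : ℕ} (x : ℕ → EuclideanSpace ℝ (Fin d)) (y : ℕ → ℝ)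

theorem gram_zero : gram x 0 = 0 := by simp [gram]

theorem gram_succ (t : ℕ) :
    gram x (t + 1) = gram x t + vecMulVec (x (t + 1)).ofLp (x (t + 1)).ofLp := by
  unfold gram
  rw [Finset.sum_Icc_succ_top (by omega)]

theorem gram_posSemidef (t : ℕ) : (gram x t).PosSemidef :=
  posSemidef_sum _ fun _ _ => posSemidef_vecMulVec_self _

theorem gram_transpose (t : ℕ) : (gram x t)ᵀ = gram x t := (gram_posSemidef x t).transpose_eq

theorem bvec_zero : bvec x y 0 = 0 := by simp [bvec]

theorem bvec_succ (t : ℕ) : bvec x y (t + 1) = bvec x y t + y (t + 1) • x (t + 1) := by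
  unfold bvec
  rw [Finset.sum_Icc_succ_top (by omega)]

theorem inner_eq_dotProduct (u v : EuclideanSpace ℝ (Fin d)) :
    inner ℝ u v = u.ofLp ⬝ᵥ v.ofLp := by
  rw [EuclideanSpace.inner_eq_star_dotProduct, star_trivial, dotProduct_comm]

theorem gram_mulVec_pinv_feature (t : ℕ) :
    gram x (t + 1) *ᵥ pinv (gram x (t + 1)) *ᵥ (x (t + 1)).ofLp = (x (t + 1)).ofLp := by
  rw [gram_succ]
  exact mul_pinv_mulVec_update (gram_posSemidef x t)

theorem gram_mulVec_pinv_bvec (t : ℕ) :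
    gram x t *ᵥ pinv (gram x t) *ᵥ (bvec x y t).ofLp = (bvec x y t).ofLp := by
  induction t with
  | zero => simp [bvec_zero]
  | succ t ih =>
    rw [bvec_succ, WithLp.ofLp_add, WithLp.ofLp_smul, mulVec_add, mulVec_add, mulVec_smul,
      mulVec_smul, gram_mulVec_pinv_feature, gram_succ,
      mul_pinv_mulVec_of_range (gram_posSemidef x t) ih]

theorem gram_succ_mulVec_pinv_bvec (t : ℕ) :
    gram x (t + 1) *ᵥ pinv (gram x (t + 1)) *ᵥ (bvec x y t).ofLp = (bvec x y t).ofLp := by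
  rw [gram_succ]
  exact mul_pinv_mulVec_of_range (gram_posSemidef x t) (gram_mulVec_pinv_bvec x y t)

theorem sum_sq_sub_inner (t : ℕ) (u : EuclideanSpace ℝ (Fin d)) :
    ∑ s ∈ Finset.Icc 1 t, (y s - inner ℝ u (x s)) ^ 2 = ∑ s ∈ Finset.Icc 1 t, y s ^ 2
      - 2 * (u.ofLp ⬝ᵥ (bvec x y t).ofLp) + u.ofLp ⬝ᵥ gram x t *ᵥ u.ofLp := by
  induction t with
  | zero => simp [bvec_zero, gram_zero]
  | succ t ih =>
    rw [Finset.sum_Icc_succ_top (by omega), Finset.sum_Icc_succ_top (by omega), ih, gram_succ,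
      dotProduct_add_vecMulVec_mulVec, bvec_succ, inner_eq_dotProduct, WithLp.ofLp_add,
      WithLp.ofLp_smul, dotProduct_add, dotProduct_smul, smul_eq_mul,
      dotProduct_comm (x (t + 1)).ofLp]
    ring

theorem dotProduct_sub_mulVec_sub {n : Type*} [Fintype n] {A : Matrix n n ℝ} (hA : Aᵀ = A)
    {b w : n → ℝ} (hw : A *ᵥ w = b) (u : n → ℝ) :
    (u - w) ⬝ᵥ A *ᵥ (u - w) = u ⬝ᵥ A *ᵥ u - 2 * (u ⬝ᵥ b) + w ⬝ᵥ b := by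
  have := dotProduct_mulVec_comm hA w u
  simp only [mulVec_sub, sub_dotProduct, dotProduct_sub]
  rw [this, hw]
  ring

/-! ### Minimality of the weights -/

theorem ridgeWeights_one : ridgeWeights x y 1 = 0 := by
  simp [ridgeWeights, bvec_zero]

/-- The objective is quadratic with matrix `G_{t+1}` and linear part `-2 b_t`; the weights solve the
normal equation `G_{t+1} û = b_t`, so completing the square is exact. -/
theorem ridgeObjective_sub (t : ℕ) (u : EuclideanSpace ℝ (Fin d)) :
    ridgeObjective x y (t + 1) u - ridgeObjective x y (t + 1) (ridgeWeights x y (t + 1))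
      = (u.ofLp - (ridgeWeights x y (t + 1)).ofLp) ⬝ᵥ
        gram x (t + 1) *ᵥ (u.ofLp - (ridgeWeights x y (t + 1)).ofLp) := by
  have hobj : ∀ v, ridgeObjective x y (t + 1) v = ∑ s ∈ Finset.Icc 1 t, y s ^ 2
      - 2 * (v.ofLp ⬝ᵥ (bvec x y t).ofLp) + v.ofLp ⬝ᵥ gram x (t + 1) *ᵥ v.ofLp := by
    intro v
    unfold ridgeObjective
    rw [Nat.add_sub_cancel, sum_sq_sub_inner, gram_succ, dotProduct_add_vecMulVec_mulVec,
      inner_eq_dotProduct, dotProduct_comm (x (t + 1)).ofLp]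
    ring
  have hw : gram x (t + 1) *ᵥ (ridgeWeights x y (t + 1)).ofLp = (bvec x y t).ofLp := by
    simpa [ridgeWeights] using gram_succ_mulVec_pinv_bvec x y t
  rw [dotProduct_sub_mulVec_sub (gram_transpose x _) hw, hobj, hobj, hw]
  ring

theorem ridgeObjective_ridgeWeights_le (t : ℕ) (v : EuclideanSpace ℝ (Fin d)) :
    ridgeObjective x y (t + 1) (ridgeWeights x y (t + 1)) ≤ ridgeObjective x y (t + 1) v := by
  rw [← sub_nonneg, ridgeObjective_sub]
  exact (gram_posSemidef x _).real_nonneg _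

/-- Another minimizer differs from `û` by a kernel vector of `G`, while `û = G† G û` is orthogonal
to that kernel. So `⟨û, v⟩ = ‖û‖²`, and Cauchy–Schwarz applies. -/
theorem norm_ridgeWeights_le (t : ℕ) {v : EuclideanSpace ℝ (Fin d)}
    (hv : ∀ w, ridgeObjective x y (t + 1) v ≤ ridgeObjective x y (t + 1) w) :
    ‖ridgeWeights x y (t + 1)‖ ≤ ‖v‖ := by
  set w := ridgeWeights x y (t + 1) with hw
  set G := gram x (t + 1)
  have h0 : (v.ofLp - w.ofLp) ⬝ᵥ G *ᵥ (v.ofLp - w.ofLp) = 0 := by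
    refine le_antisymm ?_ ((gram_posSemidef x _).real_nonneg _)
    rw [← ridgeObjective_sub, sub_nonpos]
    exact hv _
  have h1 : G *ᵥ (v.ofLp - w.ofLp) = 0 :=
    ((gram_posSemidef x (t + 1)).dotProduct_mulVec_zero_iff _).mp (by simpa using h0)
  have h2 : (pinv G * G) *ᵥ w.ofLp = w.ofLp := by
    simp only [hw, ridgeWeights, G]
    rw [mulVec_mulVec, (pinv_spec _).self_mul_mul]
  have h3 : ((pinv G * G) *ᵥ w.ofLp) ⬝ᵥ (v.ofLp - w.ofLp) = 0 := by
    rw [dotProduct_comm, dotProduct_mulVec_comm (pinv_spec G).symm_right, ← mulVec_mulVec,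
      h1, mulVec_zero, dotProduct_zero]
  rw [h2] at h3
  have h4 : inner ℝ w v = inner ℝ w w := by
    rw [inner_eq_dotProduct, inner_eq_dotProduct]
    rw [dotProduct_sub] at h3
    linarith
  have h5 := real_inner_le_norm w v
  rw [h4, real_inner_self_eq_norm_mul_norm] at h5
  by_contra hlt
  nlinarith [norm_nonneg v, norm_nonneg w]

/-! ### Regret -/

theorem leverage_mem (t : ℕ) : 0 ≤ leverage x (t + 1) ∧ leverage x (t + 1) ≤ 1 := by
  have h := leverage_sq_le (x := (x (t + 1)).ofLp) (gram_posSemidef x t)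
  rw [← gram_succ] at h
  change leverage x (t + 1) ^ 2 ≤ leverage x (t + 1) at h
  constructor <;> nlinarith [sq_nonneg (leverage x (t + 1))]

theorem sum_forecast_sq_le (T : ℕ) :
    ∑ t ∈ Finset.Icc 1 T, (y t - inner ℝ (ridgeWeights x y t) (x t)) ^ 2
      ≤ ∑ t ∈ Finset.Icc 1 T, y t ^ 2 - (bvec x y T).ofLp ⬝ᵥ pinv (gram x T) *ᵥ (bvec x y T).ofLp
        + ∑ t ∈ Finset.Icc 1 T, y t ^ 2 * leverage x t := by
  induction T with
  | zero => simp [bvec_zero]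
  | succ T ih =>
    rw [Finset.sum_Icc_succ_top (by omega), Finset.sum_Icc_succ_top (by omega),
      Finset.sum_Icc_succ_top (by omega)]
    have h := pinv_potential_step (x := (x (T + 1)).ofLp) (gram_posSemidef x T)
      (gram_mulVec_pinv_bvec x y T)
    rw [← gram_succ] at h
    have hP := pinv_transpose_of_symm (gram_transpose x (T + 1))
    have hi : inner ℝ (ridgeWeights x y (T + 1)) (x (T + 1))
        = (x (T + 1)).ofLp ⬝ᵥ pinv (gram x (T + 1)) *ᵥ (bvec x y T).ofLp := by
      rw [inner_eq_dotProduct, dotProduct_comm]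
      rfl
    have hb : (bvec x y (T + 1)).ofLp ⬝ᵥ pinv (gram x (T + 1)) *ᵥ (bvec x y (T + 1)).ofLp
        = (bvec x y T).ofLp ⬝ᵥ pinv (gram x (T + 1)) *ᵥ (bvec x y T).ofLp
          + 2 * y (T + 1) * ((x (T + 1)).ofLp ⬝ᵥ pinv (gram x (T + 1)) *ᵥ (bvec x y T).ofLp)
          + y (T + 1) ^ 2 * leverage x (T + 1) := by
      rw [bvec_succ, WithLp.ofLp_add, WithLp.ofLp_smul, mulVec_add, mulVec_smul, dotProduct_add,
        add_dotProduct, add_dotProduct, smul_dotProduct, smul_dotProduct, dotProduct_smul,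
        dotProduct_smul, dotProduct_mulVec_comm hP (bvec x y T).ofLp (x (T + 1)).ofLp]
      simp only [smul_eq_mul, leverage]
      ring
    rw [hi, hb]
    nlinarith

theorem regret_ridgeWeights_le (T : ℕ) (u : EuclideanSpace ℝ (Fin d)) :
    regret (ridgeWeights x y) x y T u ≤ ∑ t ∈ Finset.Icc 1 T, y t ^ 2 * leverage x t := by
  unfold regret
  have h1 := sum_forecast_sq_le x y T
  have h2 := sum_sq_sub_inner x y T u
  have h3 := dotProduct_sub_mulVec_sub (gram_transpose x T) (gram_mulVec_pinv_bvec x y T) u.ofLp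
  have h4 := (gram_posSemidef x T).real_nonneg
    (u.ofLp - pinv (gram x T) *ᵥ (bvec x y T).ofLp)
  rw [dotProduct_comm (pinv _ *ᵥ _)] at h3
  linarith

theorem regret_ridgeWeights_le_sum_leverage {T : ℕ} {B : ℝ} {y : ℕ → ℝ}
    (hy : ∀ t ∈ Finset.Icc 1 T, y t ∈ Set.Icc (-B) B) (u : EuclideanSpace ℝ (Fin d)) :
    regret (ridgeWeights x y) x y T u ≤ B ^ 2 * ∑ t ∈ Finset.Icc 1 T, leverage x t := by
  refine (regret_ridgeWeights_le x y T u).trans ?_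
  rw [Finset.mul_sum]
  refine Finset.sum_le_sum fun t ht => ?_
  have h := hy t ht
  obtain ⟨s, rfl⟩ : ∃ s, t = s + 1 := ⟨t - 1, by have := Finset.mem_Icc.mp ht; omega⟩
  exact mul_le_mul_of_nonneg_right (sq_le_sq' h.1 h.2) (leverage_mem x s).1

/-! ### Rank increases -/

theorem gramRank_zero : gramRank x 0 = 0 := by simp [gramRank, gram_zero]

theorem gramRank_le (t : ℕ) : gramRank x t ≤ d := by
  simpa [gramRank] using (gram x t).rank_le_card_width

theorem gramRank_le_succ (t : ℕ) : gramRank x t ≤ gramRank x (t + 1) := by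
  unfold gramRank
  rw [gram_succ]
  exact rank_le_rank_add_vecMulVec (gram_posSemidef x t)

theorem gramRank_succ_le (t : ℕ) : gramRank x (t + 1) ≤ gramRank x t + 1 := by
  unfold gramRank
  rw [gram_succ]
  exact rank_add_vecMulVec_le _ _

theorem gramRank_ne_zero {t : ℕ} (h : x (t + 1) ≠ 0) : gramRank x (t + 1) ≠ 0 := by
  intro h0
  have hG : gram x (t + 1) = 0 := by
    unfold gramRank Matrix.rank at h0
    have := Submodule.finrank_eq_zero.mp h0
    rw [LinearMap.range_eq_bot] at this
    exact ext_iff_mulVec.mpr fun v => by simpa using LinearMap.congr_fun this v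
  have hx := gram_mulVec_pinv_feature x t
  rw [hG, zero_mulVec] at hx
  exact h ((WithLp.ofLp_eq_zero 2).mp hx.symm)

theorem gramRank_eq_zero {t : ℕ} (h : ∀ s, 1 ≤ s → s ≤ t → x s = 0) : gramRank x t = 0 := by
  have : gram x t = 0 := Finset.sum_eq_zero fun s hs => by
    rw [Finset.mem_Icc] at hs
    rw [h s hs.1 hs.2]
    simp
  simp [gramRank, this]

/-- Since `G_0 = 0`, both clauses of the definition reduce to a rank change from the previous round,
including at round `1`. -/
theorem succ_mem_rankRounds_iff (t : ℕ) :
    t + 1 ∈ rankRounds x ↔ gramRank x t ≠ gramRank x (t + 1) := by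
  constructor
  · rintro (⟨⟨-, h1⟩, h2⟩ | ⟨-, h⟩)
    · rw [gramRank_eq_zero x fun s hs hst => ?_]
      · exact (gramRank_ne_zero x h1).symm
      · by_contra hne
        have := h2 ⟨hs, hne⟩
        omega
    · exact h
  · intro h
    rcases Nat.eq_zero_or_pos t with rfl | ht
    · left
      refine ⟨⟨le_rfl, fun h0 => h ?_⟩, fun s hs => hs.1⟩
      rw [gramRank_zero, gramRank_eq_zero x fun s hs hs1 => ?_]
      obtain rfl : s = 1 := le_antisymm hs1 hs
      exact h0
    · exact Or.inr ⟨by omega, h⟩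

theorem mem_rankRoundsUpTo {T t : ℕ} :
    t ∈ rankRoundsUpTo x T ↔ (1 ≤ t ∧ t ≤ T) ∧ t ∈ rankRounds x := by
  simp [rankRoundsUpTo]

theorem rankRoundsUpTo_zero : rankRoundsUpTo x 0 = ∅ := by simp [rankRoundsUpTo]

theorem rankRoundsUpTo_succ_of_eq {T : ℕ} (h : gramRank x T = gramRank x (T + 1)) :
    rankRoundsUpTo x (T + 1) = rankRoundsUpTo x T := by
  ext t
  have := (succ_mem_rankRounds_iff x T).not.mpr (not_not.mpr h)
  rw [mem_rankRoundsUpTo, mem_rankRoundsUpTo]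
  rcases eq_or_ne t (T + 1) with rfl | ht
  · simp [this]
  · have : t ≤ T + 1 ↔ t ≤ T := by omega
    rw [this]

theorem notMem_rankRoundsUpTo_succ (T : ℕ) : T + 1 ∉ rankRoundsUpTo x T := by
  simp [mem_rankRoundsUpTo]

theorem rankRoundsUpTo_succ_of_ne {T : ℕ} (h : gramRank x T ≠ gramRank x (T + 1)) :
    rankRoundsUpTo x (T + 1) = insert (T + 1) (rankRoundsUpTo x T) := by
  ext t
  have := (succ_mem_rankRounds_iff x T).mpr h
  rw [Finset.mem_insert, mem_rankRoundsUpTo, mem_rankRoundsUpTo]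
  rcases eq_or_ne t (T + 1) with rfl | ht
  · simp [this]
  · have : t ≤ T + 1 ↔ t ≤ T := by omega
    simp [this, ht]

theorem rankRoundsUpTo_mono : Monotone (rankRoundsUpTo x) := fun S T h t ht => by
  rw [mem_rankRoundsUpTo] at ht ⊢
  exact ⟨⟨ht.1.1, ht.1.2.trans h⟩, ht.2⟩

theorem card_rankRoundsUpTo (T : ℕ) : (rankRoundsUpTo x T).card = gramRank x T := by
  induction T with
  | zero => simp [rankRoundsUpTo_zero, gramRank_zero]
  | succ T ih =>
    by_cases h : gramRank x T = gramRank x (T + 1)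
    · rw [rankRoundsUpTo_succ_of_eq x h, ih, h]
    · rw [rankRoundsUpTo_succ_of_ne x h,
        Finset.card_insert_of_notMem (notMem_rankRoundsUpTo_succ x T), ih]
      have := gramRank_le_succ x T
      have := gramRank_succ_le x T
      omega

theorem gramEigenvalue_pos {t k : ℕ} (hk : 1 ≤ k) (hkr : k ≤ gramRank x t) :
    0 < gramEigenvalue x t k :=
  sortedEigenvalue_pos (gram_posSemidef x t) hk hkr

theorem gramEigenvalue_gramRank_pos {T t : ℕ} (ht : t ∈ rankRoundsUpTo x T) :
    0 < gramEigenvalue x t (gramRank x t) := by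
  rw [mem_rankRoundsUpTo] at ht
  obtain ⟨⟨h1, -⟩, h2⟩ := ht
  obtain ⟨s, rfl⟩ : ∃ s, t = s + 1 := ⟨t - 1, by omega⟩
  rw [succ_mem_rankRounds_iff] at h2
  have := gramRank_le_succ x s
  exact gramEigenvalue_pos x (by omega) le_rfl

/-! ### Sum of leverages -/

theorem gramEigenvalue_le_succ (t k : ℕ) : gramEigenvalue x t k ≤ gramEigenvalue x (t + 1) k := by
  refine sortedEigenvalue_mono _ _ (fun v => ?_) k
  rw [gram_succ, dotProduct_add_vecMulVec_mulVec]
  exact le_add_of_nonneg_right (sq_nonneg _)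

theorem leverage_le_log_pdet {t : ℕ} (h : gramRank x t = gramRank x (t + 1)) :
    leverage x (t + 1) ≤ Real.log (pdet (gram x (t + 1))) - Real.log (pdet (gram x t)) := by
  have h1 := pdet_pos (gram_posSemidef x t)
  have h2 := pdet_pos (gram_posSemidef x (t + 1))
  have hstep : pdet (gram x t) = pdet (gram x (t + 1)) * (1 - leverage x (t + 1)) := by
    unfold gramRank at h
    unfold leverage
    rw [gram_succ] at h ⊢
    exact pdet_eq_of_rank_eq (gram_posSemidef x t) h
  -- The leverage is strictly below `1` because both pseudo-determinants are positive.
  have h3 : 0 < 1 - leverage x (t + 1) := by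
    rw [hstep] at h1
    exact pos_of_mul_pos_right h1 h2.le
  rw [hstep, Real.log_mul h2.ne' h3.ne']
  have := Real.log_le_sub_one_of_pos h3
  linarith

theorem log_pdet_gram (t : ℕ) : Real.log (pdet (gram x t))
    = ∑ k ∈ Finset.Icc 1 (gramRank x t), Real.log (gramEigenvalue x t k) :=
  log_pdet (gram_posSemidef x t)

theorem sum_leverage_le (T : ℕ) :
    ∑ t ∈ Finset.Icc 1 T, leverage x t
      ≤ ∑ k ∈ Finset.Icc 1 (gramRank x T), Real.log (gramEigenvalue x T k)
        + ∑ t ∈ rankRoundsUpTo x T, Real.log (1 / gramEigenvalue x t (gramRank x t))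
        + gramRank x T := by
  induction T with
  | zero => simp [gramRank_zero, rankRoundsUpTo_zero]
  | succ T ih =>
    rw [Finset.sum_Icc_succ_top (by omega)]
    by_cases h : gramRank x T = gramRank x (T + 1)
    · have h1 := leverage_le_log_pdet x h
      rw [log_pdet_gram, log_pdet_gram] at h1
      rw [rankRoundsUpTo_succ_of_eq x h]
      rw [h] at ih h1
      linarith
    · have hr : gramRank x (T + 1) = gramRank x T + 1 := by
        have := gramRank_le_succ x T
        have := gramRank_succ_le x T
        omega
      have h1 := (leverage_mem x T).2
      have h2 : ∑ k ∈ Finset.Icc 1 (gramRank x T), Real.log (gramEigenvalue x T k)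
          ≤ ∑ k ∈ Finset.Icc 1 (gramRank x T), Real.log (gramEigenvalue x (T + 1) k) :=
        Finset.sum_le_sum fun k hk => by
          rw [Finset.mem_Icc] at hk
          exact Real.log_le_log (gramEigenvalue_pos x hk.1 hk.2) (gramEigenvalue_le_succ x T k)
      -- The new term `log (1 / λ)` cancels the log of the new last eigenvalue, and the unit
      -- increase of the rank pays for the leverage.
      rw [rankRoundsUpTo_succ_of_ne x h,
        Finset.sum_insert (notMem_rankRoundsUpTo_succ x T), hr,
        Finset.sum_Icc_succ_top (by omega), one_div, Real.log_inv]
      push_cast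
      linarith

/-! ### Bounded features -/

theorem trace_gram (T : ℕ) : (gram x T).trace = ∑ t ∈ Finset.Icc 1 T, ‖x t‖ ^ 2 := by
  unfold gram
  rw [trace_sum]
  refine Finset.sum_congr rfl fun t _ => ?_
  rw [trace_vecMulVec, ← inner_eq_dotProduct, real_inner_self_eq_norm_sq]

theorem gramEigenvalue_le {T : ℕ} {X : ℝ} (hx : ∀ t ∈ Finset.Icc 1 T, ‖x t‖ ≤ X) (k : ℕ) :
    gramEigenvalue x T k ≤ T * X ^ 2 := by
  refine (sortedEigenvalue_le_trace (gram_posSemidef x T) k).trans ?_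
  rw [trace_gram]
  refine (Finset.sum_le_card_nsmul _ _ (X ^ 2) fun t ht =>
    pow_le_pow_left₀ (norm_nonneg _) (hx t ht) 2).trans ?_
  simp

theorem sum_leverage_le_of_bounded {T : ℕ} {X : ℝ} (hT : 1 ≤ T) (hX : 0 < X)
    (hx : ∀ t ∈ Finset.Icc 1 T, ‖x t‖ ≤ X) :
    ∑ t ∈ Finset.Icc 1 T, leverage x t
      ≤ d * Real.log T + d
        + ∑ t ∈ rankRoundsUpTo x T, Real.log (X ^ 2 / gramEigenvalue x t (gramRank x t)) := by
  have hT0 : (0 : ℝ) < T := by exact_mod_cast hT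
  have hlogT : 0 ≤ Real.log T := Real.log_nonneg (by exact_mod_cast hT)
  have hrd : (gramRank x T : ℝ) ≤ d := by exact_mod_cast gramRank_le x T
  have h1 : ∑ k ∈ Finset.Icc 1 (gramRank x T), Real.log (gramEigenvalue x T k)
      ≤ gramRank x T * (Real.log T + Real.log (X ^ 2)) := by
    refine (Finset.sum_le_card_nsmul _ _ (Real.log T + Real.log (X ^ 2)) fun k hk => ?_).trans ?_
    · rw [Finset.mem_Icc] at hk
      rw [← Real.log_mul hT0.ne' (by positivity)]
      exact Real.log_le_log (gramEigenvalue_pos x hk.1 hk.2) (gramEigenvalue_le x hx k)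
    · rw [Nat.card_Icc, Nat.add_sub_cancel, nsmul_eq_mul]
  -- There are exactly `r_T` rank rounds, so the `r_T` copies of `log X²` from the eigenvalue bound
  -- can be distributed one per round.
  have h2 : ∑ t ∈ rankRoundsUpTo x T, Real.log (X ^ 2 / gramEigenvalue x t (gramRank x t))
      = gramRank x T * Real.log (X ^ 2)
        + ∑ t ∈ rankRoundsUpTo x T, Real.log (1 / gramEigenvalue x t (gramRank x t)) := by
    rw [← card_rankRoundsUpTo, ← nsmul_eq_mul, ← Finset.sum_const, ← Finset.sum_add_distrib]
    refine Finset.sum_congr rfl fun t ht => ?_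
    have := gramEigenvalue_gramRank_pos x ht
    rw [← Real.log_mul (by positivity) (by positivity), mul_one_div]
  have h3 := sum_leverage_le x T
  have h4 := mul_le_mul_of_nonneg_right hrd hlogT
  linarith

/-- The rank is at most `d`, so it attains its maximum at some `T₀`; cardinality then forbids later
rank rounds. -/
theorem exists_rankRoundsUpTo_subset : ∃ T₀, ∀ T, rankRoundsUpTo x T ⊆ rankRoundsUpTo x T₀ := by
  obtain ⟨T₀, hT₀⟩ : ∃ T₀, ∀ T, gramRank x T ≤ gramRank x T₀ := by
    have hfin : (Set.range (gramRank x)).Finite :=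
      (Set.finite_Iic d).subset (by rintro _ ⟨t, rfl⟩; exact gramRank_le x t)
    obtain ⟨T₀, hT₀⟩ := (Set.exists_max_image _ id hfin (Set.range_nonempty _)).imp fun _ h => h
    obtain ⟨⟨T, rfl⟩, h⟩ := hT₀
    exact ⟨T, fun S => h _ ⟨S, rfl⟩⟩
  refine ⟨T₀, fun T => ?_⟩
  rcases le_total T T₀ with h | h
  · exact rankRoundsUpTo_mono x h
  · rw [Finset.eq_of_subset_of_card_le (rankRoundsUpTo_mono x h)]
    rw [card_rankRoundsUpTo, card_rankRoundsUpTo]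
    exact hT₀ T

end Gram

end SeqRidge

theorem mainTheorem2 {d : ℕ} (x : ℕ → EuclideanSpace ℝ (Fin d)) :
    -- the weights `G_t† b_{t-1}` are those of the algorithm: null at `t = 1`, and for `t ≥ 2`
    -- the minimizer of minimal Euclidean norm of the round-`t` objective
    (∀ y : ℕ → ℝ,
      SeqRidge.ridgeWeights x y 1 = 0 ∧
      ∀ t : ℕ, 2 ≤ t →
        (∀ v, SeqRidge.ridgeObjective x y t (SeqRidge.ridgeWeights x y t)
          ≤ SeqRidge.ridgeObjective x y t v) ∧
        (∀ v, (∀ w, SeqRidge.ridgeObjective x y t v ≤ SeqRidge.ridgeObjective x y t w) →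
          ‖SeqRidge.ridgeWeights x y t‖ ≤ ‖v‖)) ∧
    -- the rounds at which the rank increases
    (∀ T : ℕ, 1 ≤ T →
      (SeqRidge.rankRoundsUpTo x T).card = SeqRidge.gramRank x T ∧
      ∀ t ∈ SeqRidge.rankRoundsUpTo x T,
        0 < SeqRidge.gramEigenvalue x t (SeqRidge.gramRank x t)) ∧
    -- the uniform regret bound
    (∀ (T : ℕ) (B : ℝ) (y : ℕ → ℝ), 1 ≤ T → (∀ t ∈ Finset.Icc 1 T, y t ∈ Set.Icc (-B) B) →
      BddAbove (Set.range (SeqRidge.regret (SeqRidge.ridgeWeights x y) x y T)) ∧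
      (⨆ u, SeqRidge.regret (SeqRidge.ridgeWeights x y) x y T u)
        ≤ B ^ 2 * ∑ t ∈ Finset.Icc 1 T, SeqRidge.leverage x t ∧
      B ^ 2 * ∑ t ∈ Finset.Icc 1 T, SeqRidge.leverage x t
        ≤ B ^ 2 * ∑ k ∈ Finset.Icc 1 (SeqRidge.gramRank x T),
              Real.log (SeqRidge.gramEigenvalue x T k)
          + B ^ 2 * ∑ t ∈ SeqRidge.rankRoundsUpTo x T,
              Real.log (1 / SeqRidge.gramEigenvalue x t (SeqRidge.gramRank x t))
          + SeqRidge.gramRank x T * B ^ 2) ∧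
    -- bounded features: explicit bound with leading term `d B² log T`
    (∀ (T : ℕ) (B X : ℝ) (y : ℕ → ℝ), 1 ≤ T → 0 < X → (∀ t ∈ Finset.Icc 1 T, ‖x t‖ ≤ X) →
      (∀ t ∈ Finset.Icc 1 T, y t ∈ Set.Icc (-B) B) →
      (⨆ u, SeqRidge.regret (SeqRidge.ridgeWeights x y) x y T u)
        ≤ d * B ^ 2 * Real.log T
          + (d * B ^ 2 + B ^ 2 * ∑ t ∈ SeqRidge.rankRoundsUpTo x T,
              Real.log (X ^ 2 / SeqRidge.gramEigenvalue x t (SeqRidge.gramRank x t)))) ∧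
    -- bounded features: the remainder is bounded in `T`, by a constant depending on the features
    (∀ X : ℝ, (∀ t, 1 ≤ t → ‖x t‖ ≤ X) →
      ∃ C : ℝ, ∀ (T : ℕ) (B : ℝ) (y : ℕ → ℝ), 1 ≤ T →
        (∀ t ∈ Finset.Icc 1 T, y t ∈ Set.Icc (-B) B) →
        (⨆ u, SeqRidge.regret (SeqRidge.ridgeWeights x y) x y T u)
          ≤ d * B ^ 2 * Real.log T + C * B ^ 2) := by
  have sup_le : ∀ (T : ℕ) (B : ℝ) (y : ℕ → ℝ),
      (∀ t ∈ Finset.Icc 1 T, y t ∈ Set.Icc (-B) B) →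
      (⨆ u, SeqRidge.regret (SeqRidge.ridgeWeights x y) x y T u)
        ≤ B ^ 2 * ∑ t ∈ Finset.Icc 1 T, SeqRidge.leverage x t := fun T B y hy =>
    ciSup_le fun u => SeqRidge.regret_ridgeWeights_le_sum_leverage x hy u
  refine ⟨fun y => ⟨SeqRidge.ridgeWeights_one x y, fun t ht => ?_⟩, fun T _ =>
    ⟨SeqRidge.card_rankRoundsUpTo x T, fun t ht => SeqRidge.gramEigenvalue_gramRank_pos x ht⟩,
    fun T B y _ hy => ⟨⟨B ^ 2 * ∑ t ∈ Finset.Icc 1 T, SeqRidge.leverage x t, ?_⟩, sup_le T B y hy, ?_⟩,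
    fun T B X y hT hX hx hy => ?_,
    fun X hX => ?_⟩
  · obtain ⟨s, rfl⟩ : ∃ s, t = s + 1 := ⟨t - 1, by omega⟩
    exact ⟨SeqRidge.ridgeObjective_ridgeWeights_le x y s,
      fun v hv => SeqRidge.norm_ridgeWeights_le x y s hv⟩
  · rintro _ ⟨u, rfl⟩
    exact SeqRidge.regret_ridgeWeights_le_sum_leverage x hy u
  · refine (mul_le_mul_of_nonneg_left (SeqRidge.sum_leverage_le x T) (sq_nonneg B)).trans_eq ?_
    ring
  · refine (sup_le T B y hy).trans ((mul_le_mul_of_nonneg_left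
      (SeqRidge.sum_leverage_le_of_bounded x hT hX hx) (sq_nonneg B)).trans_eq ?_)
    ring
  · obtain ⟨T₀, hT₀⟩ := SeqRidge.exists_rankRoundsUpTo_subset x
    -- `max X 1` provides the positive bound required, even if `X = 0`. Absolute values make the sum
    -- monotone in the set of rounds without a sign argument.
    refine ⟨d + ∑ t ∈ SeqRidge.rankRoundsUpTo x T₀,
      |Real.log (max X 1 ^ 2 / SeqRidge.gramEigenvalue x t (SeqRidge.gramRank x t))|,
      fun T B y hT hy => (sup_le T B y hy).trans ?_⟩
    have h := SeqRidge.sum_leverage_le_of_bounded x hT (X := max X 1) (by positivity)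
      fun t ht => (hX t (Finset.mem_Icc.mp ht).1).trans (le_max_left _ _)
    have h' := (Finset.sum_le_sum fun t _ => le_abs_self _).trans
      (Finset.sum_le_sum_of_subset_of_nonneg (hT₀ T) fun t _ _ =>
        abs_nonneg (Real.log (max X 1 ^ 2 / SeqRidge.gramEigenvalue x t (SeqRidge.gramRank x t))))
    refine (mul_le_mul_of_nonneg_left (h.trans (add_le_add_right h' _)) (sq_nonneg B)).trans_eq ?_
    ring
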